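/- Let $A$ be an $s\times n$ integer matrix of rank $m$, and let $D=UAV$ be its Smith normal form, where $U\in \mathrm{GL}_s(\mathbb Z)$, $V\in \mathrm{GL}_n(\mathbb Z)$ and $D$ is the $s\times n$ matrix that is zero off the diagonal and has nonnegative diagonal entries $d_1\mid d_2\mid\cdots\mid d_{\min(s,n)}$, so that $d_1,\dots,d_m$ are the nonzero invariant factors of $A$. Assume that $d_m=1$, that is, that all nonzero invariant factors of $A$ are $1$ (no condition if $A=0$). Let $\vec p\in\mathbb Z^n$, put $A\vec p=(b_1,\dots,b_s)$, and let $\mathcal H=\{\vec x\in\mathbb R^n : A\vec x=A\vec p\}$. A lattice point $\vec x\in\mathbb Z^n$ is called visible if $\gcd(x_1,\dots,x_n)=1$. Then the asymptotic density of visible points on $\mathcal H$ exists and is given by $$\lim_{r\to\infty}\frac{|\{\vec x\in \mathcal H\cap[-r,r]^n\cap\mathbb Z^n : \gcd(x_1,\dots,x_n)=1\}|}{|\mathcal H\cap[-r,r]^n\cap\mathbb Z^n|}=\prod_{q\mid \gcd(b_1,\dots,b_s)}\left(1-\frac1{q^{\,n-m}}\right),$$ where the product runs over the primes $q$ dividing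 $\gcd(b_1,\dots,b_s)$. If $\gcd(b_1,\dots,b_s)=0$, it runs over all primes and its value is the limit of the finite partial products (hence $1/\zeta(n-m)$ if $n-m\ge 2$, and $0$ if $n-m\le 1$). -/

import Mathlib

open Filter Topology

/-- A lattice point `x ∈ ℤⁿ` is visible (from the origin) if `gcd(x₁, …, xₙ) = 1`. -/
def IsVisiblePoint {n : ℕ} (x : Fin n → ℤ) : Prop :=
  Finset.univ.gcd x = 1

/-- `Δ₁(r) = Δ ∩ [-r, r]ⁿ ∩ ℤⁿ`, the lattice points of `Δ` in the box `[-r, r]ⁿ`. -/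
def latticePoints {n : ℕ} (Δ : Set (Fin n → ℝ)) (r : ℝ) : Set (Fin n → ℤ) :=
  {x | (fun i => (x i : ℝ)) ∈ Δ ∧ ∀ i, (x i : ℝ) ∈ Set.Icc (-r) r}

/-- `Δ₀(r)`, the visible lattice points of `Δ` in the box `[-r, r]ⁿ`. -/
def visiblePoints {n : ℕ} (Δ : Set (Fin n → ℝ)) (r : ℝ) : Set (Fin n → ℤ) :=
  {x | x ∈ latticePoints Δ r ∧ IsVisiblePoint x}

/-- The sets that are counted in the definition of the density are finite. -/
theorem latticePoints_finite {n : ℕ} (Δ : Set (Fin n → ℝ)) (r : ℝ) :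
    (latticePoints Δ r).Finite := by
  refine (Set.Finite.pi' (fun _ : Fin n => Set.finite_Icc (⌈-r⌉) (⌊r⌋))).subset ?_
  intro x hx i
  exact ⟨Int.ceil_le.2 (hx.2 i).1, Int.le_floor.2 (hx.2 i).2⟩

/-- The asymptotic density of visible lattice points in `Δ` exists and equals `ρ`:
`|Δ₀(r)| / |Δ₁(r)| → ρ` as the real number `r` tends to infinity. -/
def HasVisibleDensity {n : ℕ} (Δ : Set (Fin n → ℝ)) (ρ : ℝ) : Prop :=
  Tendsto (fun r : ℝ => ((visiblePoints Δ r).ncard : ℝ) / ((latticePoints Δ r).ncard : ℝ))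
    atTop (𝓝 ρ)

/-- The set `{x ∈ ℝⁿ : A x = b}`, the intersection of the `s` hyperplanes
`∑ⱼ aᵢⱼ xⱼ = bᵢ`. -/
def hyperplaneIntersection {s n : ℕ} (A : Matrix (Fin s) (Fin n) ℤ) (b : Fin s → ℤ) :
    Set (Fin n → ℝ) :=
  {x | Matrix.mulVec (A.map (fun a => (a : ℝ))) x = fun i => (b i : ℝ)}

/-- The `s × n` matrix with diagonal entries `d 1, d 2, …` (numbered from 1) and zeros
elsewhere. -/
def rectDiagonal (s n : ℕ) (d : ℕ → ℤ) : Matrix (Fin s) (Fin n) ℤ :=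
  Matrix.of fun i j => if i.val = j.val then d (i.val + 1) else 0

/-- `U A V = D` is a Smith normal form of the integer matrix `A`, where `D` is the `s × n`
diagonal matrix with entries `d 1 ∣ d 2 ∣ ⋯ ∣ d (min s n)`, all nonnegative. Only the values
`d i` with `1 ≤ i ≤ min s n` are relevant; they are the invariant factors of `A`, followed by
zeros from the index `rank A + 1` on. -/
structure IsSmithNormalForm {s n : ℕ} (A : Matrix (Fin s) (Fin n) ℤ)
    (U : Matrix.GeneralLinearGroup (Fin s) ℤ) (V : Matrix.GeneralLinearGroup (Fin n) ℤ)
    (d : ℕ → ℤ) : Prop where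
  mul_eq : (U : Matrix (Fin s) (Fin s) ℤ) * A * (V : Matrix (Fin n) (Fin n) ℤ)
    = rectDiagonal s n d
  nonneg : ∀ i, 1 ≤ i → i ≤ min s n → 0 ≤ d i
  dvd_succ : ∀ i, 1 ≤ i → i + 1 ≤ min s n → d i ∣ d (i + 1)

/-! Write `m` for the rank and `k = n - m`. With unit invariant factors the Smith form turns `A`
into the projection onto the first `m` coordinates. Hence the integral kernel is a copy of `ℤᵏ` with
an integral retraction, and the image of `A` is saturated: if `q • b'` is a value of `A` with `q ≠
0`, so is `b'` (`exists_mulVec_eq_of_smul`).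

Counting lattice points in a dilated convex body gives `~ c rᵏ` kernel points in the box, with `c >
0`. Translation by a bounded vector gives the same `c` for every solvable right-hand side. By
saturation, the solutions of `A x = q b'` divisible by `q` are `q` times the solutions of `A x = b'`
in the box of size `r / q`, a proportion `q⁻ᵏ`. Iterating over finitely many primes yields `c ∏ (1 -
q⁻ᵏ)` (`tendsto_ncard_sievedSolutions`).

A prime dividing `x` divides `A x = b`, so for `b ≠ 0` this finite sieve is exact. For `b = 0`
finite sieves give the upper bound. The lower bound comes from the convergent tail of `∑ q⁻ᵏ` if `k
≥ 2`, and is trivial if `k ≤ 1`, where the product is `0`. -/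

open MeasureTheory
open scoped Pointwise

/-! ### Smith normal form with unit invariant factors -/

namespace IsSmithNormalForm

variable {s n : ℕ} {A : Matrix (Fin s) (Fin n) ℤ} {U : Matrix.GeneralLinearGroup (Fin s) ℤ}
  {V : Matrix.GeneralLinearGroup (Fin n) ℤ} {d : ℕ → ℤ}

theorem dvd_of_le (h : IsSmithNormalForm A U V d) {i j : ℕ} (hi : 1 ≤ i) (hij : i ≤ j)
    (hj : j ≤ min s n) : d i ∣ d j := by
  induction j, hij using Nat.le_induction with
  | base => exact dvd_rfl
  | succ j hij ih => exact (ih (by omega)).trans (h.dvd_succ j (hi.trans hij) hj)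

theorem rank_rectDiagonal (h : IsSmithNormalForm A U V d) : (rectDiagonal s n d).rank = A.rank := by
  rw [← h.mul_eq, Matrix.rank_mul_eq_left_of_isUnit_det _ _
      ((Matrix.isUnit_iff_isUnit_det _).1 V.isUnit),
    Matrix.rank_mul_eq_right_of_isUnit_det _ _ ((Matrix.isUnit_iff_isUnit_det _).1 U.isUnit)]

theorem rank_le (_ : IsSmithNormalForm A U V d) : A.rank ≤ min s n :=
  le_min A.rank_le_height A.rank_le_width

theorem eq_one (h : IsSmithNormalForm A U V d) (hd : 1 ≤ A.rank → d A.rank = 1) {i : ℕ}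
    (hi : 1 ≤ i) (hir : i ≤ A.rank) : d i = 1 := by
  have h1 : d i ∣ 1 := hd (hi.trans hir) ▸ h.dvd_of_le hi hir h.rank_le
  exact Int.eq_one_of_dvd_one (h.nonneg i hi (hir.trans h.rank_le)) h1

theorem eq_zero (h : IsSmithNormalForm A U V d) (hd : 1 ≤ A.rank → d A.rank = 1) {i : ℕ}
    (hi : A.rank < i) (hin : i ≤ min s n) : d i = 0 := by
  -- Otherwise the leading diagonal block of size `A.rank + 1` is nonsingular, which exceeds the
  -- rank.
  have key : d (A.rank + 1) = 0 := by
    by_contra hne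
    let e₁ : Fin (A.rank + 1) → Fin s := Fin.castLE (by omega)
    let e₂ : Fin (A.rank + 1) → Fin n := Fin.castLE (by omega)
    have hsub : (rectDiagonal s n d).submatrix e₁ e₂ =
        Matrix.diagonal fun i : Fin (A.rank + 1) => d (i + 1) := by
      ext i j
      simp [rectDiagonal, Matrix.diagonal_apply, e₁, e₂, Fin.ext_iff]
    have hdet : (Matrix.diagonal fun i : Fin (A.rank + 1) => d (i + 1)).det ≠ 0 := by
      rw [Matrix.det_diagonal, Finset.prod_ne_zero_iff]
      intro i _
      rcases Nat.lt_or_ge i A.rank with hi | hi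
      · rw [h.eq_one hd (by omega) (by omega)]
        exact one_ne_zero
      · rwa [show (i : ℕ) = A.rank by omega]
    have hr := Matrix.rank_submatrix_le (rectDiagonal s n d) e₁ e₂
    rw [hsub, h.rank_rectDiagonal, ← Matrix.one_mul (Matrix.diagonal _),
      Matrix.rank_mul_eq_left_of_det_ne_zero _ _ hdet, Matrix.rank_one, Fintype.card_fin] at hr
    omega
  have := h.dvd_of_le (i := A.rank + 1) (by omega) hi hin
  rwa [key, zero_dvd_iff] at this

theorem mulVec_rectDiagonal_of_lt (y : Fin n → ℤ) (i : Fin s) (hi : (i : ℕ) < n) :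
    (rectDiagonal s n d).mulVec y i = d (i + 1) * y ⟨i, hi⟩ := by
  rw [Matrix.mulVec, dotProduct, Finset.sum_eq_single ⟨i, hi⟩]
  · simp [rectDiagonal]
  · intro j _ hj
    have : (i : ℕ) ≠ j := fun h => hj (Fin.ext h.symm)
    simp [rectDiagonal, this]
  · simp

theorem mulVec_rectDiagonal_of_ge (y : Fin n → ℤ) (i : Fin s) (hi : n ≤ (i : ℕ)) :
    (rectDiagonal s n d).mulVec y i = 0 := by
  rw [Matrix.mulVec, dotProduct]
  refine Finset.sum_eq_zero fun j _ => ?_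
  have : (i : ℕ) ≠ j := by omega
  simp [rectDiagonal, this]

theorem mulVec_rectDiagonal (h : IsSmithNormalForm A U V d) (hd : 1 ≤ A.rank → d A.rank = 1)
    (y : Fin n → ℤ) (i : Fin s) : (rectDiagonal s n d).mulVec y i =
      if hi : (i : ℕ) < A.rank then y ⟨i, hi.trans_le A.rank_le_width⟩ else 0 := by
  have hw := A.rank_le_width
  split_ifs with hi
  · rw [mulVec_rectDiagonal_of_lt y i (by omega), h.eq_one hd (by omega) (by omega), one_mul]
  · rcases Nat.lt_or_ge i n with hin | hin
    · rw [mulVec_rectDiagonal_of_lt y i hin, h.eq_zero hd (by omega) (by omega), zero_mul]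
    · exact mulVec_rectDiagonal_of_ge y i hin

theorem mulVec_mulVec (h : IsSmithNormalForm A U V d) (y : Fin n → ℤ) :
    (U : Matrix (Fin s) (Fin s) ℤ).mulVec (A.mulVec ((V : Matrix (Fin n) (Fin n) ℤ).mulVec y)) =
      (rectDiagonal s n d).mulVec y := by
  rw [Matrix.mulVec_mulVec, Matrix.mulVec_mulVec, ← h.mul_eq]

theorem mulVec_unit_injective {r : ℕ} (U : Matrix.GeneralLinearGroup (Fin r) ℤ) :
    Function.Injective (U : Matrix (Fin r) (Fin r) ℤ).mulVec :=
  Matrix.mulVec_injective_of_isUnit U.isUnit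

theorem mulVec_mulVec_inv {r : ℕ} (U : Matrix.GeneralLinearGroup (Fin r) ℤ) (x : Fin r → ℤ) :
    (U : Matrix (Fin r) (Fin r) ℤ).mulVec
      (((U⁻¹ : Matrix.GeneralLinearGroup (Fin r) ℤ) : Matrix (Fin r) (Fin r) ℤ).mulVec x) = x := by
  rw [Matrix.mulVec_mulVec, ← Units.val_mul, mul_inv_cancel, Units.val_one, Matrix.one_mulVec]

/-- If all nonzero invariant factors are `1`, the image of `A` is saturated. -/
theorem exists_mulVec_eq_of_smul (h : IsSmithNormalForm A U V d)
    (hd : 1 ≤ A.rank → d A.rank = 1) {c : ℤ} (hc : c ≠ 0) {p : Fin n → ℤ} {b : Fin s → ℤ}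
    (hp : A.mulVec p = c • b) : ∃ x, A.mulVec x = b := by
  have hw := A.rank_le_width
  have hh := A.rank_le_height
  obtain ⟨y, rfl⟩ : ∃ y, (V : Matrix (Fin n) (Fin n) ℤ).mulVec y = p := ⟨_, mulVec_mulVec_inv V p⟩
  have hy := h.mulVec_mulVec y
  rw [hp, Matrix.mulVec_smul] at hy
  set w := (U : Matrix (Fin s) (Fin s) ℤ).mulVec b with hwdef
  -- The coordinates of `w` from `A.rank` on vanish, because their multiples by `c ≠ 0` do; so
  -- nothing is lost by truncating.
  let z : Fin n → ℤ := fun j => if hj : (j : ℕ) < A.rank then w ⟨j, hj.trans_le hh⟩ else 0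
  refine ⟨(V : Matrix (Fin n) (Fin n) ℤ).mulVec z, mulVec_unit_injective U ?_⟩
  rw [h.mulVec_mulVec z, ← hwdef]
  ext i
  rw [h.mulVec_rectDiagonal hd]
  split_ifs with hi
  · simp [z, hi]
  · have := congrFun hy i
    rw [h.mulVec_rectDiagonal hd, dif_neg hi, Pi.smul_apply, smul_eq_mul] at this
    exact ((mul_eq_zero.1 this).resolve_left hc).symm

/-- An integral parametrization of the kernel of `A` with an integral left inverse. -/
theorem exists_kernel_parametrization (h : IsSmithNormalForm A U V d)
    (hd : 1 ≤ A.rank → d A.rank = 1) :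
    ∃ (W : Matrix (Fin n) (Fin (n - A.rank)) ℤ) (W' : Matrix (Fin (n - A.rank)) (Fin n) ℤ),
      W' * W = 1 ∧ A * W = 0 ∧ ∀ x, A.mulVec x = 0 → W.mulVec (W'.mulVec x) = x := by
  have hw := A.rank_le_width
  let e : Fin (n - A.rank) → Fin n := fun j => ⟨A.rank + j, by omega⟩
  have he : Function.Injective e := fun i j hij => by
    simp only [e, Fin.ext_iff] at hij ⊢
    omega
  let V' : Matrix (Fin n) (Fin n) ℤ := ((V⁻¹ : Matrix.GeneralLinearGroup (Fin n) ℤ) : _)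
  have hV : V' * (V : Matrix (Fin n) (Fin n) ℤ) = 1 := by
    rw [← Units.val_mul, inv_mul_cancel, Units.val_one]
  -- The last `n - A.rank` columns of `V`, and the matching rows of `V⁻¹`.
  refine ⟨(V : Matrix (Fin n) (Fin n) ℤ).submatrix id e, V'.submatrix e id, ?_, ?_, ?_⟩
  · rw [← Matrix.submatrix_mul _ _ e id e Function.bijective_id, hV, Matrix.submatrix_one _ he]
  · ext i j
    have hcol : A.mulVec ((V : Matrix (Fin n) (Fin n) ℤ).mulVec (Pi.single (e j) 1)) = 0 := by
      refine mulVec_unit_injective U ?_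
      rw [h.mulVec_mulVec, Matrix.mulVec_zero]
      ext i
      rw [h.mulVec_rectDiagonal hd]
      split_ifs with hi
      · exact Pi.single_eq_of_ne (by simp only [e, ne_eq, Fin.ext_iff]; omega) _
      · rfl
    rw [Matrix.mulVec_mulVec, Matrix.mulVec_single_one] at hcol
    exact congrFun hcol i
  · intro x hx
    obtain ⟨y, rfl⟩ : ∃ y, (V : Matrix (Fin n) (Fin n) ℤ).mulVec y = x :=
      ⟨_, mulVec_mulVec_inv V x⟩
    have hy := h.mulVec_mulVec y
    rw [hx, Matrix.mulVec_zero] at hy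
    have hy0 : ∀ i : Fin n, (i : ℕ) < A.rank → y i = 0 := fun i hi => by
      have := congrFun hy ⟨i, hi.trans_le A.rank_le_height⟩
      rw [h.mulVec_rectDiagonal hd, dif_pos hi] at this
      exact this.symm
    have h1 : (V'.submatrix e id).mulVec ((V : Matrix (Fin n) (Fin n) ℤ).mulVec y) = y ∘ e := by
      have : V'.mulVec ((V : Matrix (Fin n) (Fin n) ℤ).mulVec y) = y := by
        rw [Matrix.mulVec_mulVec, hV, Matrix.one_mulVec]
      ext j
      exact congrFun this (e j)
    rw [h1]
    ext i
    simp only [Matrix.mulVec, dotProduct, Matrix.submatrix_apply, id, Function.comp]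
    refine Finset.sum_of_injOn e he.injOn (by simp) ?_ (by simp)
    intro j _ hj
    rw [hy0 j, mul_zero]
    by_contra hjr
    exact hj ⟨⟨j - A.rank, by omega⟩, by simp, by simp [e, Fin.ext_iff]; omega⟩

end IsSmithNormalForm

/-- The integral solutions of `A x = b` in the box `[-r, r]ⁿ`. -/
def boxSolutions {s n : ℕ} (A : Matrix (Fin s) (Fin n) ℤ) (b : Fin s → ℤ) (r : ℝ) :
    Set (Fin n → ℤ) :=
  {x | A.mulVec x = b ∧ ∀ i, |(x i : ℝ)| ≤ r}

/-! ### Asymptotic count of the integral solutions in a box -/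

section

variable {s n k : ℕ} {A : Matrix (Fin s) (Fin n) ℤ}

theorem latticePoints_hyperplaneIntersection (A : Matrix (Fin s) (Fin n) ℤ) (b : Fin s → ℤ)
    (r : ℝ) : latticePoints (hyperplaneIntersection A b) r = boxSolutions A b r := by
  ext x
  have h : (A.map (fun a => (a : ℝ))).mulVec (fun i => (x i : ℝ)) =
      fun i => ((A.mulVec x i : ℤ) : ℝ) := by
    ext i
    simp [Matrix.mulVec, dotProduct]
  simp only [latticePoints, hyperplaneIntersection, boxSolutions, Set.mem_ofPred_eq, h, funext_iff,
    Int.cast_inj, Set.mem_Icc, abs_le]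

theorem boxSolutions_finite (A : Matrix (Fin s) (Fin n) ℤ) (b : Fin s → ℤ) (r : ℝ) :
    (boxSolutions A b r).Finite :=
  latticePoints_hyperplaneIntersection A b r ▸ latticePoints_finite _ r

theorem boxSolutions_mono (A : Matrix (Fin s) (Fin n) ℤ) (b : Fin s → ℤ) {r r' : ℝ} (h : r ≤ r') :
    boxSolutions A b r ⊆ boxSolutions A b r' :=
  fun _ hx => ⟨hx.1, fun i => (hx.2 i).trans h⟩

theorem ncard_boxSolutions_le_add {b b' : Fin s → ℤ} {v : Fin n → ℤ} (hv : A.mulVec v = b' - b)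
    {K : ℝ} (hK : ∀ i, |(v i : ℝ)| ≤ K) (r : ℝ) :
    (boxSolutions A b r).ncard ≤ (boxSolutions A b' (r + K)).ncard := by
  refine Set.ncard_le_ncard_of_injOn (fun x => x + v) ?_ (add_left_injective v).injOn
    (boxSolutions_finite A b' _)
  rintro x ⟨hx, hxr⟩
  refine ⟨by rw [Matrix.mulVec_add, hx, hv, add_sub_cancel], fun i => ?_⟩
  rw [Pi.add_apply, Int.cast_add]
  exact (abs_add_le _ _).trans (add_le_add (hxr i) (hK i))

/-- The real points `t` with `W t` in the unit box. -/
def unitBoxPreimage (W : Matrix (Fin n) (Fin k) ℤ) : Set (Fin k → ℝ) :=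
  {t | ∀ i, |(W.map (fun a => (a : ℝ))).mulVec t i| ≤ 1}

/-- Convexity is needed because it makes the frontier Lebesgue null. -/
theorem convex_unitBoxPreimage (W : Matrix (Fin n) (Fin k) ℤ) : Convex ℝ (unitBoxPreimage W) := by
  have : unitBoxPreimage W =
      (W.map (fun a => (a : ℝ))).mulVecLin ⁻¹' Set.Icc (-1) 1 := by
    ext t
    simp [unitBoxPreimage, abs_le, Pi.le_def, forall_and]
  rw [this]
  exact (convex_Icc _ _).linear_preimage _

theorem isClosed_unitBoxPreimage (W : Matrix (Fin n) (Fin k) ℤ) :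
    IsClosed (unitBoxPreimage W) := by
  simp only [unitBoxPreimage, Set.ofPred_forall]
  refine isClosed_iInter fun i => isClosed_le ?_ continuous_const
  fun_prop

theorem smul_mem_unitBoxPreimage {W : Matrix (Fin n) (Fin k) ℤ} {t : Fin k → ℝ} {x : ℝ}
    (hx : 0 < x) :
    x⁻¹ • t ∈ unitBoxPreimage W ↔ ∀ i, |(W.map (fun a => (a : ℝ))).mulVec t i| ≤ x := by
  simp only [unitBoxPreimage, Set.mem_ofPred_eq, Matrix.mulVec_smul, Pi.smul_apply, smul_eq_mul,
    abs_mul, abs_inv, abs_of_pos hx, inv_mul_le_iff₀ hx, mul_one]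

theorem abs_mulVec_le {m n : ℕ} (M : Matrix (Fin m) (Fin n) ℝ) {x : Fin n → ℝ} {c : ℝ} (hc : 0 ≤ c)
    (hx : ∀ i, |x i| ≤ c) (i : Fin m) : |M.mulVec x i| ≤ (∑ i, ∑ j, |M i j|) * c := by
  calc |M.mulVec x i| ≤ ∑ j, |M i j * x j| := by
        rw [Matrix.mulVec, dotProduct]; exact Finset.abs_sum_le_sum_abs _ _
    _ ≤ ∑ j, |M i j| * c := Finset.sum_le_sum fun j _ => by
        rw [abs_mul]; exact mul_le_mul_of_nonneg_left (hx j) (abs_nonneg _)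
    _ = (∑ j, |M i j|) * c := (Finset.sum_mul ..).symm
    _ ≤ _ := mul_le_mul_of_nonneg_right (Finset.single_le_sum
        (f := fun i => ∑ j, |M i j|) (fun i _ => Finset.sum_nonneg fun j _ => abs_nonneg _)
        (Finset.mem_univ i)) hc

/-- The left inverse recovers `t` from `W t`, so the entries of `W'` bound it. -/
theorem isBounded_unitBoxPreimage {W : Matrix (Fin n) (Fin k) ℤ} {W' : Matrix (Fin k) (Fin n) ℤ}
    (hW : W' * W = 1) : Bornology.IsBounded (unitBoxPreimage W) := by
  have hW' : W'.map (fun a => (a : ℝ)) * W.map (fun a => (a : ℝ)) = 1 := by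
    have := congrArg (Int.castRingHom ℝ).mapMatrix hW
    rwa [RingHom.mapMatrix_apply, Matrix.map_mul, map_one] at this
  refine (isBounded_iff_forall_norm_le).2 ⟨(∑ i, ∑ j, |W'.map (fun a => (a : ℝ)) i j|) * 1, ?_⟩
  intro t ht
  refine (pi_norm_le_iff_of_nonneg (by positivity)).2 fun i => ?_
  have := abs_mulVec_le (W'.map (fun a => (a : ℝ))) zero_le_one ht i
  rwa [Matrix.mulVec_mulVec, hW', Matrix.one_mulVec] at this

theorem volume_unitBoxPreimage_pos {W : Matrix (Fin n) (Fin k) ℤ}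
    {W' : Matrix (Fin k) (Fin n) ℤ} (hW : W' * W = 1) :
    0 < volume.real (unitBoxPreimage W) := by
  refine ENNReal.toReal_pos (ne_of_gt ?_) (isBounded_unitBoxPreimage hW).measure_lt_top.ne
  let O : Set (Fin k → ℝ) := {t | ∀ i, |(W.map (fun a => (a : ℝ))).mulVec t i| < 1}
  have hO : IsOpen O := by
    simp only [O, Set.ofPred_forall]
    exact isOpen_iInter_of_finite fun i => isOpen_lt (by fun_prop) continuous_const
  exact (hO.measure_pos volume ⟨0, fun i => by simp⟩).trans_le
    (measure_mono fun t ht i => (ht i).le)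

theorem mem_span_range_basisFun {t : Fin k → ℝ} :
    t ∈ Submodule.span ℤ (Set.range (Pi.basisFun ℝ (Fin k))) ↔
      ∃ z : Fin k → ℤ, t = fun i => (z i : ℝ) := by
  rw [Module.Basis.mem_span_iff_repr_mem]
  simp only [Pi.basisFun_repr, Set.mem_range, algebraMap_int_eq, eq_intCast, funext_iff]
  constructor
  · intro h
    choose z hz using h
    exact ⟨z, fun i => (hz i).symm⟩
  · rintro ⟨z, hz⟩ i
    exact ⟨z i, (hz i).symm⟩

/-- Both sides count the `t ∈ ℤᵏ` with `W t` in the box: one through `t ↦ r⁻¹ t`, the other through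
`t ↦ W t`. -/
theorem card_unitBoxPreimage_inter {W : Matrix (Fin n) (Fin k) ℤ} {W' : Matrix (Fin k) (Fin n) ℤ}
    (hW : W' * W = 1) (hA : A * W = 0) (hker : ∀ x, A.mulVec x = 0 → W.mulVec (W'.mulVec x) = x)
    {r : ℝ} (hr : 0 < r) :
    Nat.card ↑(unitBoxPreimage W ∩
      r⁻¹ • (Submodule.span ℤ (Set.range (Pi.basisFun ℝ (Fin k))) : Set (Fin k → ℝ))) =
      (boxSolutions A 0 r).ncard := by
  let T : Set (Fin k → ℤ) := {t | ∀ i, |((W.mulVec t i : ℤ) : ℝ)| ≤ r}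
  have hcast : ∀ t : Fin k → ℤ, (W.map (fun a => (a : ℝ))).mulVec (fun i => (t i : ℝ)) =
      fun i => ((W.mulVec t i : ℤ) : ℝ) := fun t => by
    ext i
    simp [Matrix.mulVec, dotProduct]
  have h1 : boxSolutions A 0 r = W.mulVec '' T := by
    ext x
    constructor
    · rintro ⟨hx, hxr⟩
      exact ⟨W'.mulVec x, fun i => by rw [hker x hx]; exact hxr i, hker x hx⟩
    · rintro ⟨t, ht, rfl⟩
      exact ⟨by rw [Matrix.mulVec_mulVec, hA, Matrix.zero_mulVec], ht⟩
  have h2 : unitBoxPreimage W ∩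
      r⁻¹ • (Submodule.span ℤ (Set.range (Pi.basisFun ℝ (Fin k))) : Set (Fin k → ℝ)) =
      (fun t : Fin k → ℤ => r⁻¹ • fun i => (t i : ℝ)) '' T := by
    ext y
    constructor
    · rintro ⟨hy, t, ht, rfl⟩
      obtain ⟨z, rfl⟩ := mem_span_range_basisFun.1 ht
      refine ⟨z, ?_, rfl⟩
      have := (smul_mem_unitBoxPreimage hr).1 hy
      rwa [hcast] at this
    · rintro ⟨z, hz, rfl⟩
      refine ⟨(smul_mem_unitBoxPreimage hr).2 ?_, Set.smul_mem_smul_set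
        (mem_span_range_basisFun.2 ⟨z, rfl⟩)⟩
      rwa [hcast]
  rw [Nat.card_coe_set_eq, h1, h2, Set.ncard_image_of_injective, Set.ncard_image_of_injective]
  · intro t t' h
    have := congrArg W'.mulVec h
    simpa only [Matrix.mulVec_mulVec, hW, Matrix.one_mulVec] using this
  · intro t t' h
    ext i
    exact_mod_cast congrFun (smul_right_injective _ (inv_ne_zero hr.ne') h) i

theorem exists_tendsto_ncard_boxSolutions_zero {W : Matrix (Fin n) (Fin k) ℤ}
    {W' : Matrix (Fin k) (Fin n) ℤ} (hW : W' * W = 1) (hA : A * W = 0)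
    (hker : ∀ x, A.mulVec x = 0 → W.mulVec (W'.mulVec x) = x) :
    ∃ c : ℝ, 0 < c ∧
      Tendsto (fun r : ℝ => ((boxSolutions A 0 r).ncard : ℝ) / r ^ k) atTop (𝓝 c) := by
  refine ⟨_, volume_unitBoxPreimage_pos hW, ?_⟩
  have h := tendsto_card_div_pow_atTop_volume' (unitBoxPreimage W) (isBounded_unitBoxPreimage hW)
    (isClosed_unitBoxPreimage W).measurableSet ((convex_unitBoxPreimage W).addHaar_frontier _) ?_
  · rw [Fintype.card_fin] at h
    refine h.congr' ?_
    filter_upwards [eventually_gt_atTop 0] with r hr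
    rw [card_unitBoxPreimage_inter hW hA hker hr]
  -- The dilates of the body increase, as required for a limit along real `r`.
  · intro x y hx hxy t ht
    rw [Set.mem_smul_set_iff_inv_smul_mem₀ hx.ne', smul_mem_unitBoxPreimage hx] at ht
    rw [Set.mem_smul_set_iff_inv_smul_mem₀ (hx.trans_le hxy).ne',
      smul_mem_unitBoxPreimage (hx.trans_le hxy)]
    exact fun i => (ht i).trans hxy

theorem tendsto_add_div_atTop (K : ℝ) : Tendsto (fun r : ℝ => (r + K) / r) atTop (𝓝 1) := by
  have h : Tendsto (fun r : ℝ => 1 + K / r) atTop (𝓝 (1 + 0)) :=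
    tendsto_const_nhds.add (tendsto_const_nhds.div_atTop tendsto_id)
  rw [add_zero] at h
  refine h.congr' ?_
  filter_upwards [eventually_ne_atTop 0] with r hr
  field_simp

theorem tendsto_comp_add_div_pow {f : ℝ → ℝ} {c : ℝ}
    (h : Tendsto (fun r : ℝ => f r / r ^ k) atTop (𝓝 c)) (K : ℝ) :
    Tendsto (fun r : ℝ => f (r + K) / r ^ k) atTop (𝓝 c) := by
  have h1 := (h.comp (tendsto_atTop_add_const_right atTop K tendsto_id)).mul
    ((tendsto_add_div_atTop K).pow k)
  rw [one_pow, mul_one] at h1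
  refine h1.congr' ?_
  filter_upwards [eventually_gt_atTop 0, eventually_gt_atTop (-K)] with r hr hrK
  have : r + K ≠ 0 := by linarith
  simp only [Function.comp, id, div_pow]
  field_simp

/-- The count of solutions in a box has the same asymptotics for all solvable right hand sides. -/
theorem tendsto_ncard_boxSolutions {c : ℝ}
    (h : Tendsto (fun r : ℝ => ((boxSolutions A 0 r).ncard : ℝ) / r ^ k) atTop (𝓝 c))
    {b : Fin s → ℤ} {p : Fin n → ℤ} (hp : A.mulVec p = b) :
    Tendsto (fun r : ℝ => ((boxSolutions A b r).ncard : ℝ) / r ^ k) atTop (𝓝 c) := by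
  let K : ℝ := ∑ i, |(p i : ℝ)|
  have hK : ∀ i, |(p i : ℝ)| ≤ K := fun i =>
    Finset.single_le_sum (f := fun i => |(p i : ℝ)|) (fun _ _ => abs_nonneg _) (Finset.mem_univ i)
  -- Translating by `p` squeezes the count between the kernel counts for `r - K` and `r + K`.
  refine tendsto_of_tendsto_of_tendsto_of_le_of_le' (tendsto_comp_add_div_pow h (-K))
    (tendsto_comp_add_div_pow h K) ?_ ?_
  · filter_upwards [eventually_gt_atTop 0] with r hr
    have := ncard_boxSolutions_le_add (b := 0) (b' := b) (by rw [hp, sub_zero]) hK (r + -K)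
    rw [neg_add_cancel_right] at this
    gcongr
  · filter_upwards [eventually_gt_atTop 0] with r hr
    have := ncard_boxSolutions_le_add (A := A) (b := b) (b' := 0) (v := -p)
      (by rw [Matrix.mulVec_neg, hp, zero_sub]) (K := K) (by simpa using hK) r
    gcongr

end

/-! ### Sieving by primes -/

section

variable {s n k : ℕ} {A : Matrix (Fin s) (Fin n) ℤ}

/-- The solutions of `A x = b` in the box `[-r, r]ⁿ` that no element of `S` divides. -/
def sievedSolutions (A : Matrix (Fin s) (Fin n) ℤ) (S : Finset ℕ) (b : Fin s → ℤ) (r : ℝ) :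
    Set (Fin n → ℤ) :=
  {x | x ∈ boxSolutions A b r ∧ ∀ q ∈ S, ¬ ∀ i, (q : ℤ) ∣ x i}

theorem sievedSolutions_subset (A : Matrix (Fin s) (Fin n) ℤ) (S : Finset ℕ) (b : Fin s → ℤ)
    (r : ℝ) : sievedSolutions A S b r ⊆ boxSolutions A b r := fun _ hx => hx.1

theorem sievedSolutions_finite (A : Matrix (Fin s) (Fin n) ℤ) (S : Finset ℕ) (b : Fin s → ℤ)
    (r : ℝ) : (sievedSolutions A S b r).Finite :=
  (boxSolutions_finite A b r).subset (sievedSolutions_subset A S b r)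

theorem smul_mem_boxSolutions {q : ℕ} (hq : 0 < q) {b : Fin s → ℤ} {r : ℝ} {x : Fin n → ℤ} :
    (q : ℤ) • x ∈ boxSolutions A ((q : ℤ) • b) r ↔ x ∈ boxSolutions A b (r / q) := by
  have hq' : (0 : ℝ) < q := Nat.cast_pos.2 hq
  have hqz : (q : ℤ) ≠ 0 := by exact_mod_cast hq.ne'
  refine and_congr ?_ (forall_congr' fun i => ?_)
  · rw [Matrix.mulVec_smul]
    exact (smul_right_injective _ hqz).eq_iff
  · rw [Pi.smul_apply, smul_eq_mul, Int.cast_mul, Int.cast_natCast, abs_mul, abs_of_pos hq',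
      le_div_iff₀' hq']

theorem exists_eq_smul_of_dvd {m : ℕ} {x : Fin m → ℤ} {q : ℤ} (h : ∀ i, q ∣ x i) :
    ∃ y, x = q • y := by
  choose y hy using h
  exact ⟨y, funext hy⟩

theorem dvd_of_dvd_mul_of_prime_ne {p q : ℕ} (hp : p.Prime) (hq : q.Prime) (hpq : p ≠ q) {a : ℤ}
    (h : (p : ℤ) ∣ q * a) : (p : ℤ) ∣ a :=
  (Nat.isCoprime_iff_coprime.2 ((Nat.coprime_primes hp hq).2 hpq)).dvd_of_dvd_mul_left h

/-- The sieve recursion: the points removed by `q` are the `q • y` with `A y = b`, and a prime of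
`S`, being different from `q`, divides `q • y` only if it divides `y`. -/
theorem ncard_sievedSolutions_insert {S : Finset ℕ} {q : ℕ} (hS : ∀ p ∈ S, p.Prime)
    (hq : q.Prime) (hqS : q ∉ S) (b : Fin s → ℤ) (r : ℝ) :
    (sievedSolutions A (insert q S) ((q : ℤ) • b) r).ncard + (sievedSolutions A S b (r / q)).ncard =
      (sievedSolutions A S ((q : ℤ) • b) r).ncard := by
  have hqz : (q : ℤ) ≠ 0 := by exact_mod_cast hq.ne_zero
  rw [← Set.ncard_image_of_injective (sievedSolutions A S b (r / q))
      (smul_right_injective (Fin n → ℤ) hqz),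
    ← Set.ncard_union_eq ?_ (sievedSolutions_finite ..) ((sievedSolutions_finite ..).image _)]
  · congr 1
    ext x
    constructor
    · rintro (⟨hx, hxS⟩ | ⟨y, ⟨hy, hyS⟩, rfl⟩)
      · exact ⟨hx, fun p hp => hxS p (Finset.mem_insert_of_mem hp)⟩
      · refine ⟨(smul_mem_boxSolutions hq.pos).2 hy, fun p hp hdvd => hyS p hp fun i => ?_⟩
        exact dvd_of_dvd_mul_of_prime_ne (hS p hp) hq (ne_of_mem_of_not_mem hp hqS) (hdvd i)
    · rintro ⟨hx, hxS⟩
      by_cases hqx : ∀ i, (q : ℤ) ∣ x i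
      · obtain ⟨y, rfl⟩ := exists_eq_smul_of_dvd hqx
        refine Or.inr ⟨y, ⟨(smul_mem_boxSolutions hq.pos).1 hx, fun p hp hdvd => ?_⟩, rfl⟩
        exact hxS p hp fun i => (hdvd i).mul_left _
      · refine Or.inl ⟨hx, fun p hp => ?_⟩
        rcases Finset.mem_insert.1 hp with rfl | hp
        · exact hqx
        · exact hxS p hp
  · rw [Set.disjoint_right]
    rintro _ ⟨y, -, rfl⟩ hx
    exact hx.2 q (Finset.mem_insert_self _ _) fun i => dvd_mul_right _ _

theorem tendsto_comp_div_div_pow {f : ℝ → ℝ} {c : ℝ}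
    (h : Tendsto (fun r : ℝ => f r / r ^ k) atTop (𝓝 c)) {q : ℝ} (hq : 0 < q) :
    Tendsto (fun r : ℝ => f (r / q) / r ^ k) atTop (𝓝 (c / q ^ k)) := by
  refine ((h.comp (tendsto_id.atTop_div_const hq)).div_const (q ^ k)).congr fun r => ?_
  simp only [Function.comp, id, div_pow]
  field_simp

/-- Sieving by finitely many primes dividing the right hand side. -/
theorem tendsto_ncard_sievedSolutions {c : ℝ}
    (h : Tendsto (fun r : ℝ => ((boxSolutions A 0 r).ncard : ℝ) / r ^ k) atTop (𝓝 c))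
    (hsat : ∀ (a : ℤ) (p : Fin n → ℤ) (b : Fin s → ℤ), a ≠ 0 → A.mulVec p = a • b →
      ∃ x, A.mulVec x = b)
    {S : Finset ℕ} (hS : ∀ q ∈ S, q.Prime) (b : Fin s → ℤ) (hb : ∃ p, A.mulVec p = b)
    (hSb : ∀ q ∈ S, ∀ i, (q : ℤ) ∣ b i) :
    Tendsto (fun r : ℝ => ((sievedSolutions A S b r).ncard : ℝ) / r ^ k) atTop
      (𝓝 (c * ∏ q ∈ S, (1 - 1 / (q : ℝ) ^ k))) := by
  -- The recursion needs the induction hypothesis at both `q • b'` and `b'`.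
  induction S using Finset.induction_on generalizing b with
  | empty =>
    obtain ⟨p, hp⟩ := hb
    simpa [sievedSolutions] using tendsto_ncard_boxSolutions h hp
  | insert q S hqS ih =>
    have hq := hS q (Finset.mem_insert_self q S)
    have hS' : ∀ p ∈ S, p.Prime := fun p hp => hS p (Finset.mem_insert_of_mem hp)
    obtain ⟨b', rfl⟩ := exists_eq_smul_of_dvd (hSb q (Finset.mem_insert_self q S))
    have hqz : (q : ℤ) ≠ 0 := by exact_mod_cast hq.ne_zero
    have hb' : ∃ p, A.mulVec p = b' := hsat q hb.choose b' hqz hb.choose_spec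
    have hSb' : ∀ p ∈ S, ∀ i, (p : ℤ) ∣ b' i := fun p hp i =>
      dvd_of_dvd_mul_of_prime_ne (hS' p hp) hq (ne_of_mem_of_not_mem hp hqS)
        (hSb p (Finset.mem_insert_of_mem hp) i)
    have h1 := ih hS' _ hb fun p hp => hSb p (Finset.mem_insert_of_mem hp)
    have h2 := tendsto_comp_div_div_pow (ih hS' b' hb' hSb') (q := q) (Nat.cast_pos.2 hq.pos)
    convert! h1.sub h2 using 2
    · rw [← ncard_sievedSolutions_insert hS' hq hqS b']
      push_cast
      ring
    · rw [Finset.prod_insert hqS]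
      ring

theorem isVisiblePoint_iff (x : Fin n → ℤ) :
    IsVisiblePoint x ↔ ∀ q : ℕ, q.Prime → ¬ ∀ i, (q : ℤ) ∣ x i := by
  have key : ∀ q : ℕ, (∀ i, (q : ℤ) ∣ x i) ↔ q ∣ (Finset.univ.gcd x).natAbs := fun q => by
    rw [← Int.natCast_dvd, Finset.dvd_gcd_iff]
    simp
  have hn : IsVisiblePoint x ↔ (Finset.univ.gcd x).natAbs = 1 := by
    rw [IsVisiblePoint, ← Int.natCast_inj, Int.natCast_natAbs, Int.abs_eq_normalize, Finset.normalize_gcd,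
      Nat.cast_one]
  rw [hn, ← not_iff_not, ← ne_eq, Nat.ne_one_iff_exists_prime_dvd]
  simp only [key, not_forall, not_not, exists_prop]

theorem visiblePoints_subset_sievedSolutions (A : Matrix (Fin s) (Fin n) ℤ) {S : Finset ℕ}
    (hS : ∀ q ∈ S, q.Prime) (b : Fin s → ℤ) (r : ℝ) :
    visiblePoints (hyperplaneIntersection A b) r ⊆ sievedSolutions A S b r := by
  rintro x ⟨hx, hv⟩
  rw [latticePoints_hyperplaneIntersection] at hx
  exact ⟨hx, fun q hq => (isVisiblePoint_iff x).1 hv q (hS q hq)⟩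

theorem visiblePoints_eq_sievedSolutions {S : Finset ℕ} {b : Fin s → ℤ}
    (hS : ∀ q : ℕ, q ∈ S ↔ q.Prime ∧ ∀ i, (q : ℤ) ∣ b i) (r : ℝ) :
    visiblePoints (hyperplaneIntersection A b) r = sievedSolutions A S b r := by
  refine (visiblePoints_subset_sievedSolutions A (fun q hq => ((hS q).1 hq).1) b r).antisymm ?_
  rintro x ⟨hx, hxS⟩
  refine ⟨by rwa [latticePoints_hyperplaneIntersection], (isVisiblePoint_iff x).2 ?_⟩
  intro q hq hdvd
  refine hxS q ((hS q).2 ⟨hq, fun i => ?_⟩) hdvd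
  rw [← hx.1, Matrix.mulVec, dotProduct]
  exact Finset.dvd_sum fun j _ => (hdvd j).mul_left _

theorem hasVisibleDensity_of_tendsto {b : Fin s → ℤ} {c ρ : ℝ} (hc : c ≠ 0)
    (h : Tendsto (fun r : ℝ => ((boxSolutions A b r).ncard : ℝ) / r ^ k) atTop (𝓝 c))
    (hv : Tendsto (fun r : ℝ => ((visiblePoints (hyperplaneIntersection A b) r).ncard : ℝ) / r ^ k)
      atTop (𝓝 (c * ρ))) :
    HasVisibleDensity (hyperplaneIntersection A b) ρ := by
  have := hv.div h hc
  rw [mul_div_cancel_left₀ _ hc] at this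
  refine this.congr' ?_
  filter_upwards [eventually_gt_atTop 0] with r hr
  rw [latticePoints_hyperplaneIntersection, Pi.div_apply,
    div_div_div_cancel_right₀ (pow_pos hr k).ne']

/-- The bound is applied at `r / q`, which may be small, so it must hold for all `r > 0`. Removing
the origin makes this possible: for `r < 1` nothing else lies in the box. -/
theorem exists_ncard_boxSolutions_zero_le {c : ℝ}
    (h : Tendsto (fun r : ℝ => ((boxSolutions A 0 r).ncard : ℝ) / r ^ k) atTop (𝓝 c)) :
    ∃ C : ℝ, 0 ≤ C ∧
      ∀ r : ℝ, 0 < r → ((boxSolutions A 0 r \ {0}).ncard : ℝ) ≤ C * r ^ k := by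
  obtain ⟨R, hR⟩ := ((h.eventually (gt_mem_nhds (lt_add_one c))).and
    (eventually_ge_atTop 1)).exists_forall_of_atTop
  refine ⟨max (c + 1) (boxSolutions A 0 R).ncard, le_max_of_le_right (Nat.cast_nonneg _), ?_⟩
  intro r hr
  rcases lt_or_ge r 1 with hr1 | hr1
  · have : boxSolutions A 0 r \ {0} = ∅ := by
      rw [Set.sdiff_eq_empty]
      rintro x ⟨-, hx⟩
      ext i
      have : |x i| < 1 := by exact_mod_cast (hx i).trans_lt hr1
      exact Int.abs_lt_one_iff.1 this
    rw [this, Set.ncard_empty, Nat.cast_zero]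
    positivity
  · have h1 : ((boxSolutions A 0 r \ {0}).ncard : ℝ) ≤ (boxSolutions A 0 r).ncard := by
      exact_mod_cast Set.ncard_le_ncard Set.sdiff_subset (boxSolutions_finite A 0 r)
    refine h1.trans ?_
    rcases le_total R r with hRr | hrR
    · have := (hR r hRr).1
      rw [div_lt_iff₀ (by positivity)] at this
      exact this.le.trans (by gcongr; exact le_max_left _ _)
    · have : ((boxSolutions A 0 r).ncard : ℝ) ≤ (boxSolutions A 0 R).ncard := by
        exact_mod_cast Set.ncard_le_ncard (boxSolutions_mono A 0 hrR) (boxSolutions_finite A 0 R)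
      calc _ ≤ ((boxSolutions A 0 R).ncard : ℝ) * 1 := by rwa [mul_one]
        _ ≤ _ := by
          gcongr
          · exact le_max_right _ _
          · exact one_le_pow₀ hr1

/-- The error made by sieving only by a finite set of primes. -/
theorem ncard_sievedSolutions_zero_le {C : ℝ}
    (hC : ∀ r : ℝ, 0 < r → ((boxSolutions A 0 r \ {0}).ncard : ℝ) ≤ C * r ^ k)
    {S : Finset ℕ} (hS : S.Nonempty) {ε : ℝ}
    (hε : ∀ T : Finset ℕ, (∀ q ∈ T, q.Prime) → Disjoint T S → ∑ q ∈ T, C * (1 / (q : ℝ) ^ k) ≤ ε)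
    {r : ℝ} (hr : 0 < r) :
    ((sievedSolutions A S 0 r).ncard : ℝ) ≤
      (visiblePoints (hyperplaneIntersection A 0) r).ncard + ε * r ^ k := by
  classical
  -- Primes above `r` cannot divide a nonzero point of the box.
  let T : Finset ℕ := {q ∈ Finset.range (⌊r⌋₊ + 1) | q.Prime ∧ q ∉ S}
  let E : ℕ → Set (Fin n → ℤ) := fun q =>
    (fun x => (q : ℤ) • x) '' (boxSolutions A 0 (r / q) \ {0})
  have hEfin : ∀ q, (E q).Finite := fun q => ((boxSolutions_finite A 0 _).sdiff).image _
  have hsub : sievedSolutions A S 0 r ⊆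
      visiblePoints (hyperplaneIntersection A 0) r ∪ ⋃ q ∈ T, E q := by
    rintro x ⟨hx, hxS⟩
    by_cases hv : IsVisiblePoint x
    · exact Or.inl ⟨by rwa [latticePoints_hyperplaneIntersection], hv⟩
    right
    rw [isVisiblePoint_iff] at hv
    push Not at hv
    obtain ⟨q, hq, hqx⟩ := hv
    obtain ⟨y, rfl⟩ := exists_eq_smul_of_dvd hqx
    -- The origin is divisible by any element of `S`; this is where `S` must be nonempty.
    have hy : y ≠ 0 := by
      rintro rfl
      obtain ⟨p, hp⟩ := hS
      exact hxS p hp fun i => by simp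
    have hyr : y ∈ boxSolutions A 0 (r / q) :=
      (smul_mem_boxSolutions hq.pos).1 (by rwa [smul_zero])
    obtain ⟨i, hi⟩ := Function.ne_iff.1 hy
    have hqr : (q : ℝ) ≤ r := by
      have h1 : (1 : ℝ) ≤ |(y i : ℝ)| := by exact_mod_cast Int.one_le_abs hi
      have h2 := h1.trans (hyr.2 i)
      rwa [one_le_div (Nat.cast_pos.2 hq.pos)] at h2
    refine Set.mem_biUnion (x := q) ?_ ⟨y, ⟨hyr, hy⟩, rfl⟩
    simp only [T, Finset.coe_filter, Set.mem_ofPred_eq, Finset.mem_range, Nat.lt_succ_iff]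
    exact ⟨Nat.le_floor hqr, hq, fun hqS => hxS q hqS hqx⟩
  have hvfin : (visiblePoints (hyperplaneIntersection A 0) r).Finite :=
    (latticePoints_finite _ r).subset fun x hx => hx.1
  have hcard : (sievedSolutions A S 0 r).ncard ≤
      (visiblePoints (hyperplaneIntersection A 0) r).ncard + ∑ q ∈ T, (E q).ncard :=
    (Set.ncard_le_ncard hsub (hvfin.union (T.finite_toSet.biUnion fun q _ => hEfin q))).trans
      ((Set.ncard_union_le _ _).trans (Nat.add_le_add_left (Finset.set_ncard_biUnion_le _ _) _))
  have hE : ∑ q ∈ T, ((E q).ncard : ℝ) ≤ ε * r ^ k := by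
    refine le_trans (Finset.sum_le_sum fun q hq => ?_) (le_trans (Finset.sum_mul T _ _).ge
      (mul_le_mul_of_nonneg_right (hε T (fun q hq => (Finset.mem_filter.1 hq).2.1)
        (Finset.disjoint_left.2 fun q hq => (Finset.mem_filter.1 hq).2.2)) (by positivity)))
    have hqp : (0 : ℝ) < q := Nat.cast_pos.2 (Finset.mem_filter.1 hq).2.1.pos
    calc ((E q).ncard : ℝ) ≤ (boxSolutions A 0 (r / q) \ {0}).ncard := by
          exact_mod_cast Set.ncard_image_le (boxSolutions_finite A 0 _).sdiff
      _ ≤ C * (r / q) ^ k := hC _ (div_pos hr hqp)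
      _ = _ := by rw [div_pow]; ring
  calc ((sievedSolutions A S 0 r).ncard : ℝ)
      ≤ (visiblePoints (hyperplaneIntersection A 0) r).ncard + ∑ q ∈ T, ((E q).ncard : ℝ) := by
        exact_mod_cast hcard
    _ ≤ _ := by gcongr

end

/-! ### Euler products -/

theorem one_sub_one_div_prime_pow_nonneg (k : ℕ) {q : ℕ} (hq : q.Prime) :
    0 ≤ 1 - 1 / (q : ℝ) ^ k := by
  rw [sub_nonneg, div_le_one (pow_pos (Nat.cast_pos.2 hq.pos) k)]
  exact one_le_pow₀ (Nat.one_le_cast.2 hq.pos)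

theorem one_sub_one_div_prime_pow_le_one (k q : ℕ) : 1 - 1 / (q : ℝ) ^ k ≤ 1 :=
  sub_le_self _ (by positivity)

/-- The Euler product `∏ (1 - q⁻ᵏ)` over all primes diverges to `0` for `k ≤ 1`. -/
theorem nonpos_of_le_prod_one_sub {k : ℕ} (hk : k ≤ 1) {ρ : ℝ}
    (hρ : ∀ S : Finset ℕ, (∀ q ∈ S, q.Prime) → ρ ≤ ∏ q ∈ S, (1 - 1 / (q : ℝ) ^ k)) : ρ ≤ 0 := by
  interval_cases k
  · simpa using hρ {2} (by simp [Nat.prime_two])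
  by_contra! hpos
  -- If `ρ > 0`, then `1 - x ≤ exp (-x)` bounds the sums of prime reciprocals by `-log ρ`,
  -- contradicting their divergence.
  have hsum : Summable fun p : Nat.Primes => 1 / ((p : ℕ) : ℝ) := by
    refine summable_of_sum_le (c := -Real.log ρ) (fun p => by positivity) fun u => ?_
    have h1 : ρ ≤ ∏ p ∈ u, (1 - 1 / ((p : ℕ) : ℝ) ^ 1) := (hρ (u.map ⟨((↑) : Nat.Primes → ℕ), Nat.Primes.coe_nat_injective⟩) (by
      intro q hq
      obtain ⟨p, -, rfl⟩ := Finset.mem_map.1 hq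
      exact p.2)).trans_eq (Finset.prod_map ..)
    have h2 : ∏ p ∈ u, (1 - 1 / ((p : ℕ) : ℝ) ^ 1) ≤ ∏ p ∈ u, Real.exp (-(1 / ((p : ℕ) : ℝ))) :=
      Finset.prod_le_prod (fun p _ => one_sub_one_div_prime_pow_nonneg 1 p.2) fun p _ => by
        rw [pow_one]; exact Real.one_sub_le_exp_neg _
    rw [← Real.exp_sum, Finset.sum_neg_distrib] at h2
    have h3 := (Real.log_le_iff_le_exp hpos).2 (h1.trans h2)
    linarith
  refine absurd (Nat.Primes.summable_rpow (r := -1)).1 (fun hf => absurd (hf ?_) (lt_irrefl _))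
  simpa [Real.rpow_neg_one] using hsum

/-! ### Visible points on the kernel -/

section

variable {s n k : ℕ} {A : Matrix (Fin s) (Fin n) ℤ}

/-- The hypotheses on `ρ` make it the infimum of the finite products. Each finite sieve bounds the
count above; below, half of the gap `c * ρ - a` absorbs the primes left unsieved when `k ≥ 2`. -/
theorem tendsto_ncard_visiblePoints_zero {c : ℝ} (hc : 0 < c)
    (h : Tendsto (fun r : ℝ => ((boxSolutions A 0 r).ncard : ℝ) / r ^ k) atTop (𝓝 c))
    (hsat : ∀ (a : ℤ) (p : Fin n → ℤ) (b : Fin s → ℤ), a ≠ 0 → A.mulVec p = a • b →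
      ∃ x, A.mulVec x = b)
    {ρ : ℝ} (hρ : ∀ S : Finset ℕ, (∀ q ∈ S, q.Prime) → ρ ≤ ∏ q ∈ S, (1 - 1 / (q : ℝ) ^ k))
    (hρ' : ∀ a, ρ < a → ∃ S : Finset ℕ, (∀ q ∈ S, q.Prime) ∧ ∏ q ∈ S, (1 - 1 / (q : ℝ) ^ k) < a) :
    Tendsto (fun r : ℝ => ((visiblePoints (hyperplaneIntersection A 0) r).ncard : ℝ) / r ^ k)
      atTop (𝓝 (c * ρ)) := by
  have hsieve : ∀ S : Finset ℕ, (∀ q ∈ S, q.Prime) →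
      Tendsto (fun r : ℝ => ((sievedSolutions A S 0 r).ncard : ℝ) / r ^ k) atTop
        (𝓝 (c * ∏ q ∈ S, (1 - 1 / (q : ℝ) ^ k))) := fun S hS =>
    tendsto_ncard_sievedSolutions h hsat hS 0 ⟨0, Matrix.mulVec_zero A⟩ fun q _ i => dvd_zero _
  rw [tendsto_order]
  constructor
  · intro a ha
    rcases Nat.lt_or_ge 1 k with hk | hk
    · obtain ⟨C, hC0, hC⟩ := exists_ncard_boxSolutions_zero_le h
      have hε : 0 < (c * ρ - a) / 2 := by linarith
      obtain ⟨S₀, hS₀⟩ := summable_iff_vanishing_norm.1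
        ((Real.summable_one_div_nat_pow.2 hk).mul_left C) _ hε
      -- Inserting `2` keeps `S` nonempty, so that the origin is sieved out.
      let S : Finset ℕ := {q ∈ insert 2 S₀ | q.Prime}
      have hS : ∀ q ∈ S, q.Prime := fun q hq => (Finset.mem_filter.1 hq).2
      have hST : ∀ T : Finset ℕ, (∀ q ∈ T, q.Prime) → Disjoint T S →
          ∑ q ∈ T, C * (1 / (q : ℝ) ^ k) ≤ (c * ρ - a) / 2 := fun T hT hTS => by
        refine (le_abs_self _).trans (hS₀ T ?_).le
        rw [Finset.disjoint_left] at hTS ⊢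
        exact fun q hq hq₀ => hTS hq
          (Finset.mem_filter.2 ⟨Finset.mem_insert_of_mem hq₀, hT q hq⟩)
      have hlt : a + (c * ρ - a) / 2 < c * ∏ q ∈ S, (1 - 1 / (q : ℝ) ^ k) :=
        lt_of_lt_of_le (by linarith) (mul_le_mul_of_nonneg_left (hρ S hS) hc.le)
      filter_upwards [(hsieve S hS).eventually (lt_mem_nhds hlt), eventually_gt_atTop 0]
        with r hr hr0
      have h1 := ncard_sievedSolutions_zero_le hC
        ⟨2, Finset.mem_filter.2 ⟨Finset.mem_insert_self _ _, Nat.prime_two⟩⟩ hST hr0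
      have hrk : 0 < r ^ k := pow_pos hr0 k
      rw [lt_div_iff₀ hrk] at hr ⊢
      linarith
    · have : c * ρ ≤ 0 := mul_nonpos_of_nonneg_of_nonpos hc.le (nonpos_of_le_prod_one_sub hk hρ)
      filter_upwards [eventually_gt_atTop 0] with r hr
      exact (ha.trans_le this).trans_le (by positivity)
  · intro a ha
    obtain ⟨S, hS, hSa⟩ := hρ' (a / c) (by rwa [lt_div_iff₀' hc])
    rw [lt_div_iff₀' hc] at hSa
    filter_upwards [(hsieve S hS).eventually (gt_mem_nhds hSa), eventually_gt_atTop 0] with r hr hr0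
    refine lt_of_le_of_lt ?_ hr
    gcongr
    · exact sievedSolutions_finite ..
    · exact visiblePoints_subset_sievedSolutions A hS 0 r

end

/-- A product of numbers in `[0, 1]` converges to the infimum of the finite products. -/
theorem exists_hasProd_of_mem_Icc {ι : Type*} {f : ι → ℝ} (h0 : ∀ i, 0 ≤ f i)
    (h1 : ∀ i, f i ≤ 1) : ∃ ρ, HasProd f ρ ∧ ∀ S : Finset ι, ρ ≤ ∏ i ∈ S, f i := by
  have hanti := Finset.prod_anti_set_of_le_one h0 h1
  have hbdd : BddBelow (Set.range fun S : Finset ι => ∏ i ∈ S, f i) :=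
    ⟨0, by rintro _ ⟨S, rfl⟩; exact Finset.prod_nonneg fun i _ => h0 i⟩
  exact ⟨_, tendsto_atTop_ciInf hanti hbdd, fun S => ciInf_le hbdd S⟩

/-! ### The density theorem -/

theorem corollary3p5 {s n : ℕ} (A : Matrix (Fin s) (Fin n) ℤ)
    (U : Matrix.GeneralLinearGroup (Fin s) ℤ) (V : Matrix.GeneralLinearGroup (Fin n) ℤ)
    (d : ℕ → ℤ) (hsnf : IsSmithNormalForm A U V d)
    (m : ℕ) (hm : m = A.rank) (hd : 1 ≤ m → d m = 1)
    (p : Fin n → ℤ) (b : Fin s → ℤ) (hb : Matrix.mulVec A p = b) :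
    ∃ ρ : ℝ,
      HasProd (fun q : {q : ℕ // q.Prime ∧ (q : ℤ) ∣ Finset.univ.gcd b} =>
        1 - 1 / ((q : ℕ) : ℝ) ^ (n - m)) ρ ∧
      HasVisibleDensity (hyperplaneIntersection A b) ρ := by
  subst hm
  obtain ⟨W, W', hW, hA, hker⟩ := hsnf.exists_kernel_parametrization hd
  obtain ⟨c, hc, h⟩ := exists_tendsto_ncard_boxSolutions_zero hW hA hker
  have hsat : ∀ (a : ℤ) (p : Fin n → ℤ) (b : Fin s → ℤ), a ≠ 0 → A.mulVec p = a • b →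
      ∃ x, A.mulVec x = b := fun a p b ha hp => hsnf.exists_mulVec_eq_of_smul hd ha hp
  have hgcd : ∀ q : ℕ, (q : ℤ) ∣ Finset.univ.gcd b ↔ ∀ i, (q : ℤ) ∣ b i := fun q => by
    simp [Finset.dvd_gcd_iff]
  by_cases hg : Finset.univ.gcd b = 0
  · obtain ⟨ρ, hprod, hle⟩ := exists_hasProd_of_mem_Icc
      (f := fun q : {q : ℕ // q.Prime ∧ (q : ℤ) ∣ Finset.univ.gcd b} =>
        1 - 1 / ((q : ℕ) : ℝ) ^ (n - A.rank))
      (fun q => one_sub_one_div_prime_pow_nonneg _ q.2.1)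
      (fun q => one_sub_one_div_prime_pow_le_one _ _)
    refine ⟨ρ, hprod, ?_⟩
    obtain rfl : b = 0 := funext fun i => Finset.gcd_eq_zero_iff.1 hg i (Finset.mem_univ i)
    refine hasVisibleDensity_of_tendsto hc.ne' h
      (tendsto_ncard_visiblePoints_zero hc h hsat (fun S hS => ?_) fun a ha => ?_)
    · refine (hle (S.subtype _)).trans_eq (Finset.prod_subtype_of_mem
        (fun q : ℕ => 1 - 1 / (q : ℝ) ^ (n - A.rank)) fun q hq => ⟨hS q hq, ?_⟩)
      rw [hg]
      exact dvd_zero _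
    · obtain ⟨S, hS⟩ := (Tendsto.eventually hprod (gt_mem_nhds ha)).exists
      refine ⟨S.map ⟨Subtype.val, Subtype.val_injective⟩, fun q hq => ?_, ?_⟩
      · obtain ⟨q, -, rfl⟩ := Finset.mem_map.1 hq
        exact q.2.1
      · rwa [Finset.prod_map]
  -- For `b ≠ 0` the primes that can divide a solution are finitely many, and sieving by them leaves
  -- exactly the visible points.
  · let S : Finset ℕ := (Finset.univ.gcd b).natAbs.primeFactors
    have hS : ∀ q : ℕ, q ∈ S ↔ q.Prime ∧ (q : ℤ) ∣ Finset.univ.gcd b := fun q => by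
      rw [Nat.mem_primeFactors, Int.natCast_dvd]
      simp [hg]
    refine ⟨∏ q ∈ S, (1 - 1 / (q : ℝ) ^ (n - A.rank)), ?_, ?_⟩
    · have : Fintype {q : ℕ // q.Prime ∧ (q : ℤ) ∣ Finset.univ.gcd b} := Fintype.subtype S hS
      rw [Finset.prod_subtype S hS]
      exact hasProd_fintype _
    · refine hasVisibleDensity_of_tendsto hc.ne' (tendsto_ncard_boxSolutions h hb) ?_
      simp only [hgcd] at hS
      simp only [visiblePoints_eq_sievedSolutions hS]
      exact tendsto_ncard_sievedSolutions h hsat (fun q hq => ((hS q).1 hq).1) b ⟨p, hb⟩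
        fun q hq => ((hS q).1 hq).2
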